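/- For positive integers $n,d$ let $F_{n,d}$ be the finite-dimensional real vector space of forms (homogeneous polynomials) of degree $d$ in $n$ variables with real coefficients, with its Euclidean topology, and let $P_{n,d}\subset F_{n,d}$ be the convex cone of forms that are nonnegative on $\mathbb{R}^n$. A face of $P_{n,d}$ is a convex subcone $\mathcal{F}\ni 0$ of $P_{n,d}$ such that $A,B\in P_{n,d}$ and $A+B\in\mathcal{F}$ imply $A,B\in\mathcal{F}$; its dimension is the dimension of its linear span. A form $P\in P_{n,d}$ is extremal if $P\neq 0$ and the ray $\{cP : c\ge 0\}$ is a face of $P_{n,d}$, and it is stubborn if no odd power $P^{2k+1}$, $k\ge 0$, is a sum of squares of forms. For $c\in\mathbb{R}$ let $$T_c = c\,X_1^3X_3^3 + (X_2^2X_3 - X_1^3 - X_1X_3^2)^2\in F_{3,6},\qquad T = T_1.$$ Then the ternary sextic $T$ is stubborn, lies on the boundary $\partial P_{3,6}$, and is not extremal in $P_{3,6}$. There is exactly one face $\mathcal{F}$ of $P_{3,6}$ that contains $T$ in its relative interior, and $\mathcal{F}$ is contained in every face of $P_{3,6}$ that contains $T$. The face $\mathcal{F}$ is two-dimensional; it is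 the convex cone $\{aT_0+bT_{\sqrt{256/27}} : a,b\ge 0\}$ generated by $T_0$ and $T_{\sqrt{256/27}}$, and both $T_0$ and $T_{\sqrt{256/27}}$ are extremal in $P_{3,6}$. -/

import Mathlib

noncomputable section

namespace NonnegForms

open MvPolynomial

/-- The real vector space `F_{n,d}` of forms (homogeneous polynomials) of degree `d` in `n`
variables. -/
abbrev Form (n d : ℕ) : Type := homogeneousSubmodule (Fin n) ℝ d

/-- The Euclidean topology of the finite-dimensional space `F_{n,d}`: forms are identified with
their families of coefficients. -/
instance instTopologicalSpaceForm (n d : ℕ) : TopologicalSpace (Form n d) :=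
  TopologicalSpace.induced
    (fun (P : Form n d) (m : Fin n →₀ ℕ) => coeff m (P : MvPolynomial (Fin n) ℝ))
    Pi.topologicalSpace

/-- The cone `P_{n,d}` of nonnegative forms. -/
def nonnegCone (n d : ℕ) : PointedCone ℝ (Form n d) where
  carrier := {P | ∀ x : Fin n → ℝ, 0 ≤ eval x (P : MvPolynomial (Fin n) ℝ)}
  zero_mem' := by intro x; simp
  add_mem' := by
    intro P Q hP hQ x
    simpa using add_nonneg (hP x) (hQ x)
  smul_mem' := by
    intro c P hP x
    have h := mul_nonneg c.2 (hP x)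
    rw [← smul_eval] at h
    exact h

/-- `P` is extremal in `P_{n,d}`: it spans an extreme ray, that is, `P ≠ 0` and the ray
`{c P : c ≥ 0}` is a face of `P_{n,d}`. -/
def IsExtremal {n d : ℕ} (P : Form n d) : Prop :=
  P ≠ 0 ∧ (PointedCone.hull ℝ {P}).IsFaceOf (nonnegCone n d)

/-- The power `P ^ k`, as a form of degree `d * k`. -/
def formPow {n d : ℕ} (P : Form n d) (k : ℕ) : Form n (d * k) :=
  ⟨(P : MvPolynomial (Fin n) ℝ) ^ k, IsHomogeneous.pow P.2 k⟩

/-- `P` is a sum of squares `H_1² + ⋯ + H_r²` of forms of degree `d / 2`. -/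
def IsSumOfSquares {n d : ℕ} (P : Form n d) : Prop :=
  ∃ e : ℕ, 2 * e = d ∧ ∃ (r : ℕ) (H : Fin r → Form n e),
    (P : MvPolynomial (Fin n) ℝ) = ∑ i, (H i : MvPolynomial (Fin n) ℝ) ^ 2

/-- A nonnegative form is stubborn if none of its odd powers is a sum of squares. -/
def IsStubborn {n d : ℕ} (P : Form n d) : Prop :=
  P ∈ nonnegCone n d ∧ ∀ k : ℕ, ¬ IsSumOfSquares (formPow P (2 * k + 1))

/-- The polynomial `c X₁³X₃³ + (X₂²X₃ − X₁³ − X₁X₃²)²`; the variables `X₁, X₂, X₃` are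
`X 0, X 1, X 2`. -/
def stenglePoly (c : ℝ) : MvPolynomial (Fin 3) ℝ :=
  C c * (X 0 ^ 3 * X 2 ^ 3) + (X 1 ^ 2 * X 2 - X 0 ^ 3 - X 0 * X 2 ^ 2) ^ 2

theorem stenglePoly_isHomogeneous (c : ℝ) : (stenglePoly c).IsHomogeneous 6 := by
  have hX : ∀ i : Fin 3, (X i : MvPolynomial (Fin 3) ℝ).IsHomogeneous 1 :=
    fun i => isHomogeneous_X ℝ i
  have hp : ∀ (i : Fin 3) (k : ℕ), (X i ^ k : MvPolynomial (Fin 3) ℝ).IsHomogeneous k :=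
    fun i k => by simpa using (hX i).pow k
  have h1 : (C c * (X 0 ^ 3 * X 2 ^ 3) : MvPolynomial (Fin 3) ℝ).IsHomogeneous 6 := by
    simpa using (isHomogeneous_C (Fin 3) c).mul ((hp 0 3).mul (hp 2 3))
  have h2 : (X 1 ^ 2 * X 2 - X 0 ^ 3 - X 0 * X 2 ^ 2 : MvPolynomial (Fin 3) ℝ).IsHomogeneous 3 :=
    (((hp 1 2).mul (hX 2)).sub (hp 0 3)).sub ((hX 0).mul (hp 2 2))
  exact h1.add (h2.pow 2)

/-- The ternary sextic `T_c = c X₁³X₃³ + (X₂²X₃ − X₁³ − X₁X₃²)²`. -/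
def stengleForm (c : ℝ) : Form 3 6 := ⟨stenglePoly c, stenglePoly_isHomogeneous c⟩

end NonnegForms

end

/-! Write `m = √(256/27)`. On the cubic `y² = x³ + x` (with `z = 1`) the form `T` equals `x³`, an
odd power. If `T ^ (2k+1) = ∑ Hᵢ²`, each `Hᵢ` restricts to `A(x) + y B(x)`, and averaging over `±y`
gives `A² + (x³ + x) B² ≤ x ^ (6k+3)` for `x > 0`. Comparing order at `0` with growth at infinity
forces `A = B = 0`, so all `Hᵢ` vanish on the cubic while `T` does not.

The smallest face containing `T` consists of the nonnegative `P` with `P ≤ L T` for some `L`. Such a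
`P` must vanish at least as fast as `T` along curves tangent to the cubic to high order at the zeros
`(0:1:0)` and `(0:0:1)`. This kills all but two degrees of freedom: `P = a T₀ + b X₁³X₃³`
(`eval_eq_of_le_mul_stengleForm`). Nonnegativity at two points then places `P` in the cone spanned
by `T₀` and `T_m`, and `T` is a strictly positive combination of these. Extremality, dimension and
uniqueness of the face are read off in the coordinates `(a, b)` of this cone. -/

open MvPolynomial NonnegForms Filter Topology

/-! ### Vanishing order and growth of real polynomials -/

/-- A polynomial that is `O(t ^ N)` as `t` tends to `0` from the right is divisible by `X ^ N`. -/
theorem Polynomial.X_pow_dvd_of_abs_eval_le (C : ℝ) (N : ℕ) (q : Polynomial ℝ)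
    (h : ∀ t : ℝ, 0 < t → t ≤ 1 → |q.eval t| ≤ C * t ^ N) : Polynomial.X ^ N ∣ q := by
  induction N generalizing q with
  | zero => simp
  | succ N ih =>
    have h0 : q.eval 0 = 0 := by
      have h1 : Tendsto (fun t : ℝ => |q.eval t|) (𝓝[>] 0) (𝓝 |q.eval 0|) :=
        (q.continuous.abs.tendsto 0).mono_left nhdsWithin_le_nhds
      have h2 : Tendsto (fun t : ℝ => C * t ^ (N + 1)) (𝓝[>] 0) (𝓝 (C * 0 ^ (N + 1))) :=
        ((by fun_prop : Continuous fun t : ℝ => C * t ^ (N + 1)).tendsto 0).mono_left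
          nhdsWithin_le_nhds
      have h3 : |q.eval 0| ≤ C * 0 ^ (N + 1) := by
        refine le_of_tendsto_of_tendsto h1 h2 ?_
        filter_upwards [Ioc_mem_nhdsGT (zero_lt_one' ℝ)] with t ht using h t ht.1 ht.2
      simpa using h3
    obtain ⟨r, rfl⟩ : Polynomial.X ∣ q := by
      rw [Polynomial.X_dvd_iff, Polynomial.coeff_zero_eq_eval_zero, h0]
    rw [pow_succ']
    refine mul_dvd_mul_left _ (ih r fun t h0 h1 => ?_)
    have h2 := h t h0 h1
    rw [Polynomial.eval_mul, Polynomial.eval_X, abs_mul, abs_of_pos h0] at h2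
    refine le_of_mul_le_mul_left (h2.trans_eq ?_) h0
    ring

/-- A polynomial that is bounded by `C * t ^ M` for `t ≥ 1` has degree at most `M`. -/
theorem Polynomial.natDegree_le_of_abs_eval_le (C : ℝ) (M : ℕ) (q : Polynomial ℝ)
    (h : ∀ t : ℝ, 1 ≤ t → |q.eval t| ≤ C * t ^ M) : q.natDegree ≤ M := by
  by_contra! hM
  have hq : (Polynomial.X ^ M : Polynomial ℝ).degree < q.degree := by
    apply Polynomial.degree_lt_degree
    rwa [Polynomial.natDegree_X_pow]
  have ht := Polynomial.abs_div_tendsto_atTop_atTop_of_degree_gt q (Polynomial.X ^ M) hq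
    (pow_ne_zero _ Polynomial.X_ne_zero)
  obtain ⟨t, h1, h2⟩ := ((ht.eventually_gt_atTop C).and (eventually_ge_atTop 1)).exists
  have hp : (0 : ℝ) < t ^ M := by positivity
  rw [Polynomial.eval_pow, Polynomial.eval_X, abs_div, abs_of_pos hp, lt_div_iff₀ hp] at h1
  linarith [h t h2]

/-- If `∑ a k t ^ k + R t t ^ N = O(t ^ N)` with `R` continuous, then all `a k` vanish. -/
theorem eq_zero_of_abs_sum_le (N : ℕ) (a : Fin N → ℝ) (R G : ℝ → ℝ) (hR : Continuous R)
    (hG : Continuous G)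
    (h : ∀ t : ℝ, 0 < t → t ≤ 1 → |∑ k, a k * t ^ (k : ℕ) + R t * t ^ N| ≤ G t * t ^ N)
    (k : Fin N) : a k = 0 := by
  obtain ⟨D, hD⟩ := (isCompact_Icc (a := (0 : ℝ)) (b := 1)).exists_bound_of_continuousOn
    hR.continuousOn
  obtain ⟨C, hC⟩ := (isCompact_Icc (a := (0 : ℝ)) (b := 1)).exists_bound_of_continuousOn
    hG.continuousOn
  have hdvd := Polynomial.X_pow_dvd_of_abs_eval_le (C + D) N
    (∑ k, Polynomial.C (a k) * Polynomial.X ^ (k : ℕ)) (fun t h0 h1 => by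
      have h2 := h t h0 h1
      have h4 : |R t * t ^ N| ≤ D * t ^ N := by
        rw [abs_mul, abs_of_pos (pow_pos h0 N)]
        exact mul_le_mul_of_nonneg_right (hD t ⟨h0.le, h1⟩) (by positivity)
      have h5 : G t * t ^ N ≤ C * t ^ N :=
        mul_le_mul_of_nonneg_right ((le_abs_self _).trans (hC t ⟨h0.le, h1⟩)) (by positivity)
      simp only [Polynomial.eval_finsetSum, Polynomial.eval_mul, Polynomial.eval_C,
        Polynomial.eval_pow, Polynomial.eval_X]
      rw [abs_le] at *
      constructor <;> linarith)
  have := Polynomial.X_pow_dvd_iff.1 hdvd k k.2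
  simpa [Polynomial.finsetSum_coeff, Polynomial.coeff_C_mul, Polynomial.coeff_X_pow, Fin.val_inj]
    using this

/-! ### Restriction to the cubic and stubbornness -/

/-- On the affine cubic `y² = x³ + x`, a form restricts to `A(x) + y B(x)`. -/
theorem exists_eval_eq_add_mul_on_cubic (P : MvPolynomial (Fin 3) ℝ) :
    ∃ A B : Polynomial ℝ, ∀ x y : ℝ, y ^ 2 = x ^ 3 + x →
      eval ![x, y, 1] P = A.eval x + y * B.eval x := by
  induction P using MvPolynomial.induction_on with
  | C a => exact ⟨Polynomial.C a, 0, fun x y _ => by simp⟩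
  | add p q hp hq =>
    obtain ⟨A, B, h⟩ := hp
    obtain ⟨A', B', h'⟩ := hq
    refine ⟨A + A', B + B', fun x y hxy => ?_⟩
    rw [eval_add, h x y hxy, h' x y hxy, Polynomial.eval_add, Polynomial.eval_add]
    ring
  | mul_X p i hp =>
    obtain ⟨A, B, h⟩ := hp
    fin_cases i
    · refine ⟨A * Polynomial.X, B * Polynomial.X, fun x y hxy => ?_⟩
      simp [h x y hxy]
      ring
    · refine ⟨B * (Polynomial.X ^ 3 + Polynomial.X), A, fun x y hxy => ?_⟩
      simp [h x y hxy, ← hxy]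
      ring
    · refine ⟨A, B, fun x y hxy => ?_⟩
      simp [h x y hxy]

/-- If `A ≠ 0`, the bound near `0` gives `deg A² ≥ N` and the bound at infinity gives `deg A² ≤ N`;
but `deg A²` is even. -/
theorem Polynomial.eq_zero_of_sq_eval_le_odd_pow (A : Polynomial ℝ) (N : ℕ) (hN : Odd N)
    (h : ∀ x : ℝ, 0 < x → A.eval x ^ 2 ≤ x ^ N) : A = 0 := by
  by_contra hA
  have hb : ∀ x : ℝ, 0 < x → |(A ^ 2).eval x| ≤ 1 * x ^ N := fun x hx => by
    rw [Polynomial.eval_pow, abs_of_nonneg (sq_nonneg _), one_mul]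
    exact h x hx
  have h1 := Polynomial.X_pow_dvd_of_abs_eval_le 1 N (A ^ 2) fun t h0 _ => hb t h0
  have h2 := Polynomial.natDegree_le_of_abs_eval_le 1 N (A ^ 2) fun t h0 => hb t (by linarith)
  have h3 := Polynomial.natDegree_le_of_dvd h1 (pow_ne_zero 2 hA)
  rw [Polynomial.natDegree_X_pow, Polynomial.natDegree_pow] at *
  obtain ⟨k, rfl⟩ := hN
  omega

/-- If `B ≠ 0`, the term `B²` gives `deg B² ≥ N` near `0`, while the term `(x B)²` gives `deg B² + 2
≤ N` at infinity. -/
theorem Polynomial.eq_zero_of_mul_sq_eval_le_pow (B : Polynomial ℝ) (N : ℕ)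
    (h : ∀ x : ℝ, 0 < x → (x ^ 2 + 1) * B.eval x ^ 2 ≤ x ^ N) : B = 0 := by
  by_contra hB
  have h1 := Polynomial.X_pow_dvd_of_abs_eval_le 1 N (B ^ 2) fun t h0 _ => by
    rw [Polynomial.eval_pow, abs_of_nonneg (sq_nonneg _)]
    nlinarith [h t h0, sq_nonneg (t * B.eval t)]
  have h2 := Polynomial.natDegree_le_of_abs_eval_le 1 N ((Polynomial.X * B) ^ 2) fun t h0 => by
    rw [Polynomial.eval_pow, abs_of_nonneg (sq_nonneg _), Polynomial.eval_mul, Polynomial.eval_X]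
    nlinarith [h t (by linarith), sq_nonneg (B.eval t)]
  have h3 := Polynomial.natDegree_le_of_dvd h1 (pow_ne_zero 2 hB)
  rw [Polynomial.natDegree_X_pow, Polynomial.natDegree_pow] at *
  rw [Polynomial.natDegree_mul Polynomial.X_ne_zero hB, Polynomial.natDegree_X] at h2
  omega

@[simp] theorem eval_stengleForm (c : ℝ) (x : Fin 3 → ℝ) :
    eval x (stengleForm c : MvPolynomial (Fin 3) ℝ) =
      c * (x 0 ^ 3 * x 2 ^ 3) + (x 1 ^ 2 * x 2 - x 0 ^ 3 - x 0 * x 2 ^ 2) ^ 2 := by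
  simp [stengleForm, stenglePoly]

/-- A polynomial whose square is bounded by an odd power of `T` vanishes on the real points of the
affine cubic with positive abscissa. -/
theorem eval_eq_zero_of_sq_le_stengle_pow (H : MvPolynomial (Fin 3) ℝ) (k : ℕ)
    (h : ∀ v : Fin 3 → ℝ, eval v H ^ 2 ≤
      eval v (stengleForm 1 : MvPolynomial (Fin 3) ℝ) ^ (2 * k + 1))
    (x y : ℝ) (hxy : y ^ 2 = x ^ 3 + x) : eval ![x, y, 1] H = 0 := by
  obtain ⟨A, B, hAB⟩ := exists_eval_eq_add_mul_on_cubic H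
  have key : ∀ x : ℝ, 0 < x →
      A.eval x ^ 2 + (x ^ 3 + x) * B.eval x ^ 2 ≤ x ^ (3 * (2 * k + 1)) := by
    intro x hx
    have hy : √(x ^ 3 + x) ^ 2 = x ^ 3 + x := Real.sq_sqrt (by positivity)
    -- Adding the bounds at `y` and `-y` cancels the cross term `2 y A B`.
    have hy' : (-√(x ^ 3 + x)) ^ 2 = x ^ 3 + x := by rw [neg_sq, hy]
    have e1 := h ![x, √(x ^ 3 + x), 1]
    have e2 := h ![x, -√(x ^ 3 + x), 1]
    rw [hAB _ _ hy, eval_stengleForm] at e1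
    rw [hAB _ _ hy', eval_stengleForm] at e2
    simp [hy] at e1 e2
    rw [pow_mul]
    generalize √(x ^ 3 + x) = y at *
    rw [← hy]
    linarith
  have hA : A = 0 := Polynomial.eq_zero_of_sq_eval_le_odd_pow A (3 * (2 * k + 1))
    ⟨3 * k + 1, by ring⟩ fun x hx => by
      have : 0 ≤ (x ^ 3 + x) * B.eval x ^ 2 := by positivity
      linarith [key x hx]
  have hB : B = 0 := Polynomial.eq_zero_of_mul_sq_eval_le_pow B (6 * k + 2) fun x hx => by
    refine le_of_mul_le_mul_left ?_ hx
    have h1 := key x hx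
    rw [show 3 * (2 * k + 1) = 6 * k + 2 + 1 by ring, pow_succ' x (6 * k + 2)] at h1
    nlinarith [sq_nonneg (A.eval x)]
  rw [hAB x y hxy, hA, hB]
  simp

theorem not_isSumOfSquares_formPow_stengleForm (k : ℕ) :
    ¬ IsSumOfSquares (formPow (stengleForm 1) (2 * k + 1)) := by
  rintro ⟨e, -, r, H, hH⟩
  have hev : ∀ v : Fin 3 → ℝ, eval v (stengleForm 1 : MvPolynomial (Fin 3) ℝ) ^ (2 * k + 1) =
      ∑ i, eval v (H i : MvPolynomial (Fin 3) ℝ) ^ 2 := fun v => by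
    simpa [formPow] using congrArg (eval v) hH
  have hy : √(1 ^ 3 + 1) ^ 2 = (1 : ℝ) ^ 3 + 1 := Real.sq_sqrt (by norm_num)
  have h0 : ∀ i, eval ![1, √(1 ^ 3 + 1), 1] (H i : MvPolynomial (Fin 3) ℝ) = 0 := fun i =>
    eval_eq_zero_of_sq_le_stengle_pow _ k (fun v => by
      rw [hev v]
      exact Finset.single_le_sum (f := fun i => eval v (H i : MvPolynomial (Fin 3) ℝ) ^ 2)
        (fun _ _ => sq_nonneg _) (Finset.mem_univ i)) _ _ hy
  have h1 := hev ![1, √(1 ^ 3 + 1), 1]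
  rw [eval_stengleForm] at h1
  simp only [h0] at h1
  simp [-Real.sq_sqrt] at h1
  norm_num at h1

/-! ### Sextics dominated by a multiple of `T` -/

/-- A ternary sextic in terms of its coefficients. -/
theorem eval_ternary_sextic (P : Form 3 6) (x : Fin 3 → ℝ) :
    eval x (P : MvPolynomial (Fin 3) ℝ) = ∑ i ∈ Finset.range 7, ∑ l ∈ Finset.range (7 - i),
      coeff (Finsupp.equivFunOnFinite.symm ![i, 6 - i - l, l]) (P : MvPolynomial (Fin 3) ℝ) *
        (x 0 ^ i * x 1 ^ (6 - i - l) * x 2 ^ l) := by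
  have hdeg : ∀ m ∈ (P : MvPolynomial (Fin 3) ℝ).support, m 0 + m 1 + m 2 = 6 := fun m hm => by
    have h := (mem_homogeneousSubmodule _ _).1 P.2 (mem_support_iff.1 hm)
    simpa [Finsupp.weight_apply, Finsupp.sum_fintype, Fin.sum_univ_three] using h
  have hm' : ∀ m : Fin 3 →₀ ℕ, m 0 + m 1 + m 2 = 6 →
      Finsupp.equivFunOnFinite.symm ![m 0, 6 - m 0 - m 2, m 2] = m := fun m hm => by
    ext j
    fin_cases j <;> simp
    omega
  rw [eval_eq', Finset.sum_sigma']
  refine Finset.sum_of_injOn (fun m => (⟨m 0, m 2⟩ : (_ : ℕ) × ℕ)) ?_ ?_ ?_ ?_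
  · intro m hm m' hm'' h
    simp only [Sigma.mk.injEq, heq_eq_eq] at h
    rw [← hm' m (hdeg m hm), ← hm' m' (hdeg m' hm''), h.1, h.2]
  · intro m hm
    have := hdeg m hm
    simp
    omega
  · rintro ⟨i, l⟩ hil hn
    simp only [Finset.mem_sigma, Finset.mem_range] at hil
    rw [mul_eq_zero]
    left
    by_contra hc
    refine hn ⟨_, mem_support_iff.2 hc, ?_⟩
    simp
  · intro m hm
    dsimp only
    have := hdeg m hm
    rw [hm' m this, Fin.prod_univ_three, show 6 - m 0 - m 2 = m 1 by omega]

/-- A nonnegative form dominated by a multiple of `T` is a combination of `T₀` and `X₁³X₃³`. -/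
theorem eval_eq_of_le_mul_stengleForm (P : Form 3 6) (L : ℝ)
    (h0 : ∀ v : Fin 3 → ℝ, 0 ≤ eval v (P : MvPolynomial (Fin 3) ℝ))
    (h : ∀ v : Fin 3 → ℝ, eval v (P : MvPolynomial (Fin 3) ℝ) ≤
      L * eval v (stengleForm 1 : MvPolynomial (Fin 3) ℝ)) :
    ∃ a b : ℝ, ∀ v : Fin 3 → ℝ, eval v (P : MvPolynomial (Fin 3) ℝ) =
      b * (v 0 ^ 3 * v 2 ^ 3) + a * (v 1 ^ 2 * v 2 - v 0 ^ 3 - v 0 * v 2 ^ 2) ^ 2 := by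
  obtain ⟨c, hc⟩ : ∃ c : ℕ → ℕ → ℝ, ∀ x : Fin 3 → ℝ,
      eval x (P : MvPolynomial (Fin 3) ℝ) = ∑ i ∈ Finset.range 7, ∑ l ∈ Finset.range (7 - i),
        c i l * (x 0 ^ i * x 1 ^ (6 - i - l) * x 2 ^ l) := ⟨_, eval_ternary_sextic P⟩
  -- Here `c i l` is the coefficient of `x^i y^(6-i-l) z^l`. Along `(t, 1, t³)`, which follows the
  -- cubic at `(0:1:0)`, `T = t¹² + t¹⁴`; hence the coefficients of `t⁰, …, t¹¹` in `P` vanish. The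
  -- vector lists them, and the next function is the remainder divided by `t¹²`.
  have hA := eq_zero_of_abs_sum_le 12
    ![c 0 0, c 1 0, c 2 0, c 0 1 + c 3 0, c 1 1 + c 4 0, c 2 1 + c 5 0, c 0 2 + c 3 1 + c 6 0,
    c 1 2 + c 4 1, c 2 2 + c 5 1, c 0 3 + c 3 2, c 1 3 + c 4 2, c 2 3]
    (fun t => c 0 4 + c 3 3 + c 1 4 * t ^ 1 + c 2 4 * t ^ 2 + c 0 5 * t ^ 3 + c 1 5 * t ^ 4 +
    c 0 6 * t ^ 6)
    (fun t => L * (1 + t ^ 2))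
    (by fun_prop) (by fun_prop) (fun t ht _ => by
      have h1 := h0 ![t, 1, t ^ 3]
      have h2 := h ![t, 1, t ^ 3]
      rw [hc] at h1 h2
      simp [Finset.sum_range_succ] at h1 h2
      simp [Fin.sum_univ_succ]
      rw [abs_le]
      constructor <;> linarith)
  -- On the first curve, monomials with equal `i + 3l` merge. The perturbation `t⁶` of `z` keeps `T
  -- = O(t¹²)`, since it moves the cubic's equation only by order `t⁶`, and separates them.
  have hA' := eq_zero_of_abs_sum_le 12
    ![c 0 0, c 1 0, c 2 0, c 0 1 + c 3 0, c 1 1 + c 4 0, c 2 1 + c 5 0,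
    c 0 1 + c 0 2 + c 3 1 + c 6 0, c 1 1 + c 1 2 + c 4 1, c 2 1 + c 2 2 + c 5 1,
    2 * c 0 2 + c 0 3 + c 3 1 + c 3 2, 2 * c 1 2 + c 1 3 + c 4 1 + c 4 2,
    2 * c 2 2 + c 2 3 + c 5 1]
    (fun t => c 0 2 + 3 * c 0 3 + c 0 4 + 2 * c 3 2 + c 3 3 + (c 1 2 + 3 * c 1 3 + c 1 4 +
    2 * c 4 2) * t ^ 1 + (c 2 2 + 3 * c 2 3 + c 2 4) * t ^ 2 + (3 * c 0 3 + 4 * c 0 4 + c 0 5 +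
    c 3 2 + 3 * c 3 3) * t ^ 3 + (3 * c 1 3 + 4 * c 1 4 + c 1 5 + c 4 2) * t ^ 4 + (3 * c 2 3 +
    4 * c 2 4) * t ^ 5 + (c 0 3 + 6 * c 0 4 + 5 * c 0 5 + c 0 6 + 3 * c 3 3) * t ^ 6 + (c 1 3 +
    6 * c 1 4 + 5 * c 1 5) * t ^ 7 + (c 2 3 + 6 * c 2 4) * t ^ 8 + (4 * c 0 4 + 10 * c 0 5 +
    6 * c 0 6 + c 3 3) * t ^ 9 + (4 * c 1 4 + 10 * c 1 5) * t ^ 10 + 4 * c 2 4 * t ^ 11 + (c 0 4 +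
    10 * c 0 5 + 15 * c 0 6) * t ^ 12 + (c 1 4 + 10 * c 1 5) * t ^ 13 + c 2 4 * t ^ 14 +
    (5 * c 0 5 + 20 * c 0 6) * t ^ 15 + 5 * c 1 5 * t ^ 16 + (c 0 5 + 15 * c 0 6) * t ^ 18 +
    c 1 5 * t ^ 19 + 6 * c 0 6 * t ^ 21 + c 0 6 * t ^ 24)
    (fun t => L * ((1 + t ^ 3) ^ 3 + (1 - t * (1 + t ^ 3) ^ 2) ^ 2))
    (by fun_prop) (by fun_prop) (fun t ht _ => by
      have h1 := h0 ![t, 1, t ^ 3 + t ^ 6]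
      have h2 := h ![t, 1, t ^ 3 + t ^ 6]
      rw [hc] at h1 h2
      simp [Finset.sum_range_succ] at h1 h2
      simp [Fin.sum_univ_succ]
      rw [abs_le]
      constructor <;> linarith)
  -- The same at `(0:0:1)`: along `(t², t, 1)`, `T = t⁶ + t¹²`. The perturbation by `t³` in `hB'`
  -- again preserves the order of `T`.
  have hB := eq_zero_of_abs_sum_le 6
    ![c 0 6, c 0 5, c 0 4 + c 1 5, c 0 3 + c 1 4, c 0 2 + c 1 3 + c 2 4, c 0 1 + c 1 2 + c 2 3]
    (fun t => c 0 0 + c 1 1 + c 2 2 + c 3 3 + (c 1 0 + c 2 1 + c 3 2) * t ^ 1 + (c 2 0 + c 3 1 +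
    c 4 2) * t ^ 2 + (c 3 0 + c 4 1) * t ^ 3 + (c 4 0 + c 5 1) * t ^ 4 + c 5 0 * t ^ 5 +
    c 6 0 * t ^ 6)
    (fun t => L * (1 + t ^ 6))
    (by fun_prop) (by fun_prop) (fun t ht _ => by
      have h1 := h0 ![t ^ 2, t, 1]
      have h2 := h ![t ^ 2, t, 1]
      rw [hc] at h1 h2
      simp [Finset.sum_range_succ] at h1 h2
      simp [Fin.sum_univ_succ]
      rw [abs_le]
      constructor <;> linarith)
  have hB' := eq_zero_of_abs_sum_le 6
    ![c 0 6, c 0 5, c 0 4 + c 1 5, c 0 3 + c 1 4 + c 1 5, c 0 2 + c 1 3 + c 1 4 + c 2 4,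
    c 0 1 + c 1 2 + c 1 3 + c 2 3 + 2 * c 2 4]
    (fun t => c 0 0 + c 1 1 + c 1 2 + c 2 2 + 2 * c 2 3 + c 2 4 + c 3 3 + (c 1 0 + c 1 1 + c 2 1 +
    2 * c 2 2 + c 2 3 + c 3 2 + 3 * c 3 3) * t ^ 1 + (c 1 0 + c 2 0 + 2 * c 2 1 + c 2 2 + c 3 1 +
    3 * c 3 2 + 3 * c 3 3 + c 4 2) * t ^ 2 + (2 * c 2 0 + c 2 1 + c 3 0 + 3 * c 3 1 + 3 * c 3 2 +
    c 3 3 + c 4 1 + 4 * c 4 2) * t ^ 3 + (c 2 0 + 3 * c 3 0 + 3 * c 3 1 + c 3 2 + c 4 0 +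
    4 * c 4 1 + 6 * c 4 2 + c 5 1) * t ^ 4 + (3 * c 3 0 + c 3 1 + 4 * c 4 0 + 6 * c 4 1 +
    4 * c 4 2 + c 5 0 + 5 * c 5 1) * t ^ 5 + (c 3 0 + 6 * c 4 0 + 4 * c 4 1 + c 4 2 + 5 * c 5 0 +
    10 * c 5 1 + c 6 0) * t ^ 6 + (4 * c 4 0 + c 4 1 + 10 * c 5 0 + 10 * c 5 1 +
    6 * c 6 0) * t ^ 7 + (c 4 0 + 10 * c 5 0 + 5 * c 5 1 + 15 * c 6 0) * t ^ 8 + (5 * c 5 0 +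
    c 5 1 + 20 * c 6 0) * t ^ 9 + (c 5 0 + 15 * c 6 0) * t ^ 10 + 6 * c 6 0 * t ^ 11 +
    c 6 0 * t ^ 12)
    (fun t => L * ((1 + t) ^ 3 + (1 + t ^ 3 * (1 + t) ^ 3) ^ 2))
    (by fun_prop) (by fun_prop) (fun t ht _ => by
      have h1 := h0 ![t ^ 2 + t ^ 3, t, 1]
      have h2 := h ![t ^ 2 + t ^ 3, t, 1]
      rw [hc] at h1 h2
      simp [Finset.sum_range_succ] at h1 h2
      simp [Fin.sum_univ_succ]
      rw [abs_le]
      constructor <;> linarith)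
  simp [Fin.forall_fin_succ] at hA hA' hB hB'
  obtain ⟨a1, a2, a3, a4, a5, a6, a7, a8, a9, a10, a11, a12⟩ := hA
  obtain ⟨b1, b2, b3, b4, b5, b6, b7, b8, b9, b10, b11, b12⟩ := hA'
  obtain ⟨d1, d2, d3, d4, d5, d6⟩ := hB
  obtain ⟨f1, f2, f3, f4, f5, f6⟩ := hB'
  have e00 : c 0 0 = 0 := by linarith
  have e10 : c 1 0 = 0 := by linarith
  have e20 : c 2 0 = 0 := by linarith
  have e01 : c 0 1 = 0 := by linarith
  have e30 : c 3 0 = 0 := by linarith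
  have e11 : c 1 1 = 0 := by linarith
  have e40 : c 4 0 = 0 := by linarith
  have e21 : c 2 1 = 0 := by linarith
  have e50 : c 5 0 = 0 := by linarith
  have e41 : c 4 1 = 0 := by linarith
  have e12 : c 1 2 = 0 := by linarith
  have e51 : c 5 1 = 0 := by linarith
  have e22 : c 2 2 = 0 := by linarith
  have e23 : c 2 3 = 0 := by linarith
  have e06 : c 0 6 = 0 := by linarith
  have e05 : c 0 5 = 0 := by linarith
  have e15 : c 1 5 = 0 := by linarith
  have e04 : c 0 4 = 0 := by linarith
  have e14 : c 1 4 = 0 := by linarith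
  have e03 : c 0 3 = 0 := by linarith
  have e32 : c 3 2 = 0 := by linarith
  have e31 : c 3 1 = -2 * c 0 2 := by linarith
  have e60 : c 6 0 = c 0 2 := by linarith
  have e42 : c 4 2 = 2 * c 0 2 := by linarith
  have e13 : c 1 3 = -2 * c 0 2 := by linarith
  have e24 : c 2 4 = c 0 2 := by linarith
  refine ⟨c 0 2, c 3 3, fun v => ?_⟩
  rw [hc]
  simp [Finset.sum_range_succ]
  simp only [e00, e10, e20, e01, e30, e11, e40, e21, e50, e41, e12, e51, e22, e23, e06,
    e05, e15, e04, e14, e03, e32, e31, e60, e42, e13, e24]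
  ring

/-! ### Evaluation, topology and finitely generated cones -/

theorem NonnegForms.Form.ext_eval {n d : ℕ} {P Q : Form n d}
    (h : ∀ v : Fin n → ℝ, eval v (P : MvPolynomial (Fin n) ℝ) =
      eval v (Q : MvPolynomial (Fin n) ℝ)) : P = Q :=
  Subtype.ext (MvPolynomial.funext h)

theorem NonnegForms.mem_nonnegCone {n d : ℕ} {P : Form n d} :
    P ∈ nonnegCone n d ↔ ∀ v : Fin n → ℝ, 0 ≤ eval v (P : MvPolynomial (Fin n) ℝ) :=
  Iff.rfl

theorem continuous_eval_ternary_sextic (x : Fin 3 → ℝ) :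
    Continuous fun P : Form 3 6 => eval x (P : MvPolynomial (Fin 3) ℝ) := by
  simp only [eval_ternary_sextic]
  refine continuous_finsetSum _ fun i _ => continuous_finsetSum _ fun l _ => ?_
  refine Continuous.mul ?_ continuous_const
  exact (continuous_apply _).comp continuous_induced_dom

theorem continuous_add_smul_form {n d : ℕ} (P Q : Form n d) :
    Continuous fun s : ℝ => P + s • Q := by
  refine continuous_induced_rng.2 (continuous_pi fun m => ?_)
  simp only [Function.comp_def, Submodule.coe_add, Submodule.coe_smul, coeff_add, coeff_smul,
    smul_eq_mul]
  fun_prop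

theorem PointedCone.mem_hull_pair {E : Type*} [AddCommGroup E] [Module ℝ E] {x y z : E} :
    z ∈ PointedCone.hull ℝ {x, y} ↔ ∃ a b : ℝ, 0 ≤ a ∧ 0 ≤ b ∧ z = a • x + b • y := by
  rw [PointedCone.hull, Submodule.mem_span_pair]
  constructor
  · rintro ⟨a, b, rfl⟩
    exact ⟨a, b, a.2, b.2, rfl⟩
  · rintro ⟨a, b, ha, hb, rfl⟩
    exact ⟨⟨a, ha⟩, ⟨b, hb⟩, rfl⟩

theorem PointedCone.mem_hull_singleton {E : Type*} [AddCommGroup E] [Module ℝ E] {x z : E} :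
    z ∈ PointedCone.hull ℝ {x} ↔ ∃ a : ℝ, 0 ≤ a ∧ z = a • x := by
  rw [PointedCone.hull, Submodule.mem_span_singleton]
  constructor
  · rintro ⟨a, rfl⟩
    exact ⟨a, a.2, rfl⟩
  · rintro ⟨a, ha, rfl⟩
    exact ⟨⟨a, ha⟩, rfl⟩

/-! ### The face generated by `T₀` and `T_m` -/

theorem sqrt_256_div_27 : √(256 / 27 : ℝ) = 16 * √3 / 9 := by
  rw [Real.sqrt_eq_iff_mul_self_eq_of_pos (by positivity)]
  have := Real.mul_self_sqrt (show (0 : ℝ) ≤ 3 by norm_num)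
  linear_combination 256 / 81 * this

theorem one_lt_sqrt_256_div_27 : 1 < √(256 / 27 : ℝ) := by
  rw [Real.lt_sqrt (by norm_num)]
  norm_num

/-- Only `xz < 0` matters. There the cross term of the square is nonnegative, so the square is at
least `x²(x² + z²)²`. AM-GM for `x², z²/3, z²/3, z²/3` gives `(x² + z²)⁴ ≥ (256/27) x² z⁶`, with
equality at `z² = 3x²`; this is where the constant comes from. -/
theorem stengleForm_mem_nonnegCone {c : ℝ} (h0 : 0 ≤ c) (h1 : c ≤ √(256 / 27)) :
    stengleForm c ∈ nonnegCone 3 6 := by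
  rw [mem_nonnegCone]
  intro v
  rw [eval_stengleForm]
  generalize v 0 = x
  generalize v 1 = y
  generalize v 2 = z
  rcases le_or_gt 0 (x * z) with hxz | hxz
  · have : 0 ≤ c * (x * z) ^ 3 := by positivity
    nlinarith [sq_nonneg (y ^ 2 * z - x ^ 3 - x * z ^ 2)]
  · have hc : c ^ 2 ≤ 256 / 27 := (Real.le_sqrt h0 (by norm_num)).1 h1
    have hw : 0 < -(x * z) := by linarith
    have hAMGM : (c * (-(x * z)) ^ 3) ^ 2 ≤ ((x * (x ^ 2 + z ^ 2)) ^ 2) ^ 2 := by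
      have e : ((x * (x ^ 2 + z ^ 2)) ^ 2) ^ 2 - 256 / 27 * ((-(x * z)) ^ 3) ^ 2 =
          x ^ 4 * ((3 * x ^ 2 - z ^ 2) ^ 2 *
            (3 * x ^ 4 + 14 * (x ^ 2 * z ^ 2) + 27 * z ^ 4)) / 27 := by ring
      have e1 : 0 ≤ x ^ 4 * ((3 * x ^ 2 - z ^ 2) ^ 2 *
          (3 * x ^ 4 + 14 * (x ^ 2 * z ^ 2) + 27 * z ^ 4)) / 27 := by positivity
      have e2 := mul_le_mul_of_nonneg_right hc (sq_nonneg ((-(x * z)) ^ 3))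
      rw [mul_pow]
      linarith
    have h2 : c * (-(x * z)) ^ 3 ≤ (x * (x ^ 2 + z ^ 2)) ^ 2 :=
      le_of_sq_le_sq hAMGM (by positivity)
    have h3 : 0 ≤ y ^ 2 * (-(x * z)) * (x ^ 2 + z ^ 2) := by positivity
    nlinarith [sq_nonneg (y ^ 2 * z)]

theorem stengleForm_one_eq : stengleForm 1 =
    (1 - 1 / √(256 / 27)) • stengleForm 0 + (1 / √(256 / 27)) • stengleForm √(256 / 27) := by
  have hm := one_lt_sqrt_256_div_27
  generalize √(256 / 27 : ℝ) = m at *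
  refine Form.ext_eval fun v => ?_
  simp only [Submodule.coe_add, Submodule.coe_smul, eval_add, smul_eval, eval_stengleForm]
  have : m ≠ 0 := by linarith
  field_simp
  ring

/-- The cone generated by `T₀` and `T_{√(256/27)}`. -/
noncomputable def stengleFace : PointedCone ℝ (Form 3 6) :=
  PointedCone.hull ℝ {stengleForm 0, stengleForm √(256 / 27)}

theorem mem_stengleFace {P : Form 3 6} : P ∈ stengleFace ↔ ∃ a b : ℝ, 0 ≤ a ∧ 0 ≤ b ∧
    P = a • stengleForm 0 + b • stengleForm √(256 / 27) :=
  PointedCone.mem_hull_pair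

theorem stengleForm_one_mem_stengleFace : stengleForm 1 ∈ stengleFace := by
  have hm := one_lt_sqrt_256_div_27
  refine mem_stengleFace.2 ⟨_, _, ?_, by positivity, stengleForm_one_eq⟩
  rw [sub_nonneg, div_le_one (by linarith)]
  exact hm.le

/-- The coordinates of a combination of `T₀` and `T_{√(256/27)}` are read off from its values. -/
theorem eval_smul_add_smul (a b : ℝ) :
    eval ![1, √2, 1] ((a • stengleForm 0 + b • stengleForm √(256 / 27) : Form 3 6) :
      MvPolynomial (Fin 3) ℝ) = b * √(256 / 27) ∧
    eval ![1, 0, 0] ((a • stengleForm 0 + b • stengleForm √(256 / 27) : Form 3 6) :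
      MvPolynomial (Fin 3) ℝ) = a + b := by
  simp only [Submodule.coe_add, Submodule.coe_smul, eval_add, smul_eval, eval_stengleForm]
  have h2 : √2 ^ 2 = (2 : ℝ) := Real.sq_sqrt (by norm_num)
  generalize √(256 / 27 : ℝ) = m
  constructor
  · simp [h2]
    ring
  · simp

theorem smul_add_smul_injective {a b a' b' : ℝ}
    (h : a • stengleForm 0 + b • stengleForm √(256 / 27) =
      a' • stengleForm 0 + b' • stengleForm √(256 / 27)) : a = a' ∧ b = b' := by
  have hm := one_lt_sqrt_256_div_27
  obtain ⟨h1, h2⟩ := eval_smul_add_smul a b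
  obtain ⟨h3, h4⟩ := eval_smul_add_smul a' b'
  rw [h] at h1 h2
  have h5 : b = b' := mul_right_cancel₀ (by linarith) (h1.symm.trans h3)
  exact ⟨by linarith, h5⟩

theorem mem_stengleFace_of_sub_mem {P : Form 3 6} (hP : P ∈ nonnegCone 3 6) {L : ℝ}
    (h : L • stengleForm 1 - P ∈ nonnegCone 3 6) : P ∈ stengleFace := by
  have hle : ∀ v : Fin 3 → ℝ, eval v (P : MvPolynomial (Fin 3) ℝ) ≤
      L * eval v (stengleForm 1 : MvPolynomial (Fin 3) ℝ) := fun v => by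
    have := h v
    rw [Submodule.coe_sub, Submodule.coe_smul, eval_sub, smul_eval] at this
    linarith
  obtain ⟨a, b, hab⟩ := eval_eq_of_le_mul_stengleForm P L hP hle
  have hm := one_lt_sqrt_256_div_27
  have h2 : √2 ^ 2 = (2 : ℝ) := Real.sq_sqrt (by norm_num)
  have h3 : √3 ^ 2 = (3 : ℝ) := Real.sq_sqrt (by norm_num)
  have h3' : 0 < √(3 : ℝ) := by positivity
  -- At `(1, √2, 1)`, on the cubic, only the `b` term survives.
  have hb : 0 ≤ b := by
    have := hP ![1, √2, 1]
    rw [hab] at this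
    simp [h2] at this
    norm_num at this
    exact this
  -- `(-1, 0, √3)` is the equality case of AM-GM, a zero of `T_m`.
  have ha : 0 ≤ a - b / √(256 / 27) := by
    have := hP ![-1, 0, √3]
    rw [hab] at this
    simp [h3] at this
    rw [show √3 ^ 3 = 3 * √(3 : ℝ) by linear_combination √3 * h3] at this
    rw [sqrt_256_div_27, sub_nonneg, div_le_iff₀ (by positivity)]
    nlinarith
  refine mem_stengleFace.2 ⟨a - b / √(256 / 27), b / √(256 / 27), ha, by positivity,
    Form.ext_eval fun v => ?_⟩
  rw [hab]
  generalize √(256 / 27 : ℝ) = m at *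
  simp only [Submodule.coe_add, Submodule.coe_smul, eval_add, smul_eval, eval_stengleForm]
  have : m ≠ 0 := by linarith
  field_simp
  ring

theorem stengleFace_le : stengleFace ≤ nonnegCone 3 6 := by
  have hm := one_lt_sqrt_256_div_27
  refine Submodule.span_le.2 ?_
  rintro P (rfl | rfl)
  · exact stengleForm_mem_nonnegCone le_rfl (by linarith)
  · exact stengleForm_mem_nonnegCone (by linarith) le_rfl

theorem exists_smul_sub_mem_nonnegCone {P : Form 3 6} (hP : P ∈ stengleFace) :
    ∃ L : ℝ, L • stengleForm 1 - P ∈ nonnegCone 3 6 := by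
  obtain ⟨a, b, ha, hb, rfl⟩ := mem_stengleFace.1 hP
  have hm := one_lt_sqrt_256_div_27
  -- From `T = (1 - 1/m) T₀ + (1/m) T_m`: `T₀ ≤ T / (1 - 1/m)` and `T_m ≤ m T`.
  refine ⟨a / (1 - 1 / √(256 / 27)) + b * √(256 / 27), stengleFace_le (mem_stengleFace.2
    ⟨b * (√(256 / 27) - 1), a / (1 - 1 / √(256 / 27)) * (1 / √(256 / 27)), ?_, ?_, ?_⟩)⟩
  · exact mul_nonneg hb (by linarith)
  · have : 0 < 1 - 1 / √(256 / 27 : ℝ) := by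
      rw [sub_pos, div_lt_one (by linarith)]
      exact hm
    positivity
  · rw [stengleForm_one_eq]
    generalize √(256 / 27 : ℝ) = m at *
    have h1 : m ≠ 0 := by linarith
    have h2 : m - 1 ≠ 0 := by linarith
    match_scalars <;> field_simp <;> ring

/-- Being dominated by a multiple of `T` passes to nonnegative summands, and characterises this cone
among nonnegative forms. -/
theorem stengleFace_isFaceOf : stengleFace.IsFaceOf (nonnegCone 3 6) := by
  refine ⟨stengleFace_le, fun {x y a} hx hy ha h => ?_⟩
  obtain ⟨L, hL⟩ := exists_smul_sub_mem_nonnegCone h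
  refine mem_stengleFace_of_sub_mem hx (L := a⁻¹ * L) ?_
  have h1 := (nonnegCone 3 6).smul_mem (inv_nonneg.2 ha.le) (add_mem hL hy)
  convert h1 using 1
  match_scalars <;> field_simp
  ring

/-! ### Extremality -/

theorem isExtremal_stengleForm_zero : IsExtremal (stengleForm 0) := by
  have hm := one_lt_sqrt_256_div_27
  refine ⟨fun h => ?_, ?_, fun {x y c} hx hy hc h => ?_⟩
  · have := congrArg (fun P : Form 3 6 => eval ![1, 0, 0] (P : MvPolynomial (Fin 3) ℝ)) h
    simp at this
  · refine (Submodule.span_mono ?_).trans stengleFace_le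
    simp
  · obtain ⟨r, hr, hxy⟩ := PointedCone.mem_hull_singleton.1 h
    have hF : c • x + y ∈ stengleFace := mem_stengleFace.2 ⟨r, 0, hr, le_rfl, by simp [hxy]⟩
    obtain ⟨a, b, ha, hb, rfl⟩ :=
      mem_stengleFace.1 (stengleFace_isFaceOf.mem_of_smul_add_mem hx hy hc hF)
    obtain ⟨a', b', ha', hb', rfl⟩ := mem_stengleFace.1
      (stengleFace_isFaceOf.mem_of_smul_add_smul_mem_right hx hy hc one_pos (by simpa using hF))
    have h1 := (smul_add_smul_injective (a := c * a + a') (b := c * b + b') (a' := r) (b' := 0)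
      (by rw [zero_smul, add_zero, ← hxy]; module)).2
    have hb0 : b = 0 := by nlinarith
    exact PointedCone.mem_hull_singleton.2 ⟨a, ha, by simp [hb0]⟩

theorem isExtremal_stengleForm_sqrt : IsExtremal (stengleForm √(256 / 27)) := by
  have hm := one_lt_sqrt_256_div_27
  refine ⟨fun h => ?_, ?_, fun {x y c} hx hy hc h => ?_⟩
  · have := congrArg (fun P : Form 3 6 => eval ![1, 0, 0] (P : MvPolynomial (Fin 3) ℝ)) h
    simp at this
  · refine (Submodule.span_mono ?_).trans stengleFace_le
    simp
  · obtain ⟨r, hr, hxy⟩ := PointedCone.mem_hull_singleton.1 h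
    have hF : c • x + y ∈ stengleFace := mem_stengleFace.2 ⟨0, r, le_rfl, hr, by simp [hxy]⟩
    obtain ⟨a, b, ha, hb, rfl⟩ :=
      mem_stengleFace.1 (stengleFace_isFaceOf.mem_of_smul_add_mem hx hy hc hF)
    obtain ⟨a', b', ha', hb', rfl⟩ := mem_stengleFace.1
      (stengleFace_isFaceOf.mem_of_smul_add_smul_mem_right hx hy hc one_pos (by simpa using hF))
    have h1 := (smul_add_smul_injective (a := c * a + a') (b := c * b + b') (a' := 0) (b' := r)
      (by rw [zero_smul, zero_add, ← hxy]; module)).1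
    have ha0 : a = 0 := by nlinarith
    exact PointedCone.mem_hull_singleton.2 ⟨b, hb, by simp [ha0]⟩

theorem stengleFace_le_of_mem {G : PointedCone ℝ (Form 3 6)} (hG : G.IsFaceOf (nonnegCone 3 6))
    (hT : stengleForm 1 ∈ G) : stengleFace ≤ G := by
  have hm := one_lt_sqrt_256_div_27
  have h0 := stengleForm_mem_nonnegCone (c := 0) le_rfl (by linarith)
  have h1 := stengleForm_mem_nonnegCone (c := √(256 / 27)) (by linarith) le_rfl
  have hp : 0 < 1 / √(256 / 27 : ℝ) := by positivity
  have hp' : 0 < 1 - 1 / √(256 / 27 : ℝ) := by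
    rw [sub_pos, div_lt_one (by linarith)]
    exact hm
  rw [stengleForm_one_eq] at hT
  refine Submodule.span_le.2 ?_
  rintro P (rfl | rfl)
  · exact hG.mem_of_smul_add_smul_mem_left h0 h1 hp' hp hT
  · exact hG.mem_of_smul_add_smul_mem_right h0 h1 hp' hp hT

theorem not_isExtremal_stengleForm_one : ¬ IsExtremal (stengleForm 1) := by
  rintro ⟨-, h⟩
  have h0 : stengleForm 0 ∈ PointedCone.hull ℝ {stengleForm 1} :=
    stengleFace_le_of_mem h (PointedCone.mem_hull_singleton.2 ⟨1, zero_le_one, by simp⟩)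
      (PointedCone.subset_hull (by simp))
  obtain ⟨r, -, hr⟩ := PointedCone.mem_hull_singleton.1 h0
  have hm := one_lt_sqrt_256_div_27
  have h1 := smul_add_smul_injective (a := 1) (b := 0) (a' := r * (1 - 1 / √(256 / 27)))
    (b' := r * (1 / √(256 / 27))) (by
      rw [zero_smul, add_zero, one_smul]
      refine hr.trans ?_
      rw [stengleForm_one_eq]
      module)
  have hp : 0 < 1 / √(256 / 27 : ℝ) := by positivity
  have hr0 : r = 0 := by
    rcases mul_eq_zero.1 h1.2.symm with h | h
    · exact h
    · linarith
  simp [hr0] at h1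

/-! ### Boundary, relative interior and dimension -/

theorem stengleForm_one_mem_frontier :
    stengleForm 1 ∈ frontier (nonnegCone 3 6 : Set (Form 3 6)) := by
  have hm := one_lt_sqrt_256_div_27
  refine ⟨subset_closure (stengleForm_mem_nonnegCone zero_le_one hm.le), fun hint => ?_⟩
  -- `T` vanishes at `(0, 1, 0)`, so `T - s X₂⁶` is negative there for every `s > 0`.
  let Q : Form 3 6 := ⟨-X 1 ^ 6, (mem_homogeneousSubmodule _ _).2
    (by simpa using ((isHomogeneous_X ℝ (1 : Fin 3)).pow 6).neg)⟩
  have hc := (continuous_add_smul_form (stengleForm 1) Q).tendsto 0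
  rw [zero_smul, add_zero] at hc
  have hev := hc.eventually (mem_interior_iff_mem_nhds.1 hint)
  obtain ⟨s, hs, hs0⟩ := ((hev.filter_mono nhdsWithin_le_nhds).and
    (self_mem_nhdsWithin (s := Set.Ioi (0 : ℝ)))).exists
  have := hs ![0, 1, 0]
  rw [Submodule.coe_add, Submodule.coe_smul, eval_add, smul_eval, eval_stengleForm] at this
  simp [Q] at this
  exact absurd hs0 (not_lt.2 this)

theorem stengleForm_one_mem_intrinsicInterior :
    stengleForm 1 ∈ intrinsicInterior ℝ (stengleFace : Set (Form 3 6)) := by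
  have hm := one_lt_sqrt_256_div_27
  rw [mem_intrinsicInterior]
  refine ⟨⟨stengleForm 1, subset_affineSpan ℝ _ stengleForm_one_mem_stengleFace⟩, ?_, rfl⟩
  rw [mem_interior_iff_mem_nhds]
  have c1 : Continuous fun P : affineSpan ℝ (stengleFace : Set (Form 3 6)) =>
      eval ![1, √2, 1] ((P : Form 3 6) : MvPolynomial (Fin 3) ℝ) :=
    (continuous_eval_ternary_sextic _).comp continuous_subtype_val
  have c2 : Continuous fun P : affineSpan ℝ (stengleFace : Set (Form 3 6)) =>
      √(256 / 27) * eval ![1, 0, 0] ((P : Form 3 6) : MvPolynomial (Fin 3) ℝ) :=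
    continuous_const.mul ((continuous_eval_ternary_sextic _).comp continuous_subtype_val)
  -- For `P = a T₀ + b T_m` these two open conditions read `0 < b m` and `b m < m (a + b)`, that is
  -- `b > 0` and `a > 0`.
  have o1 := isOpen_lt continuous_const c1 (f := fun _ => (0 : ℝ))
  have o2 := isOpen_lt c1 c2
  obtain ⟨h1, h2⟩ := eval_smul_add_smul (1 - 1 / √(256 / 27)) (1 / √(256 / 27))
  rw [← stengleForm_one_eq] at h1 h2
  rw [one_div_mul_cancel (by linarith)] at h1
  refine mem_of_superset (inter_mem (o1.mem_nhds (by simp [h1])) (o2.mem_nhds ?_)) ?_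
  · rw [Set.mem_ofPred_eq, h1, h2]
    simpa using hm
  · rintro ⟨P, hP⟩ ⟨p1, p2⟩
    have hspan : P ∈ Submodule.span ℝ {stengleForm 0, stengleForm √(256 / 27)} := by
      have h3 := affineSpan_subset_span hP
      refine Submodule.span_le.2 ?_ h3
      exact PointedCone.hull_le_span _ _
    obtain ⟨a, b, rfl⟩ := Submodule.mem_span_pair.1 hspan
    obtain ⟨q1, q2⟩ := eval_smul_add_smul a b
    simp only [Set.mem_ofPred_eq, q1, q2] at p1 p2
    refine mem_stengleFace.2 ⟨a, b, ?_, ?_, rfl⟩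
    · nlinarith
    · exact (pos_of_mul_pos_left p1 (by linarith)).le

/-- For `P ∈ G`, relative interiority lets the segment from `P` to `T` be prolonged slightly beyond
`T` inside `G`. So `(1 + s) T` is a sum of `s P` and an element of `G`, and the face property puts
`P` in `stengleFace`. -/
theorem eq_stengleFace_of_mem_intrinsicInterior {G : PointedCone ℝ (Form 3 6)}
    (hG : G.IsFaceOf (nonnegCone 3 6))
    (hT : stengleForm 1 ∈ intrinsicInterior ℝ (G : Set (Form 3 6))) : G = stengleFace := by
  have hTG : stengleForm 1 ∈ G := intrinsicInterior_subset hT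
  refine le_antisymm (fun P hP => ?_) (stengleFace_le_of_mem hG hTG)
  obtain ⟨y, hy, hyT⟩ := mem_intrinsicInterior.1 hT
  have hmem : ∀ s : ℝ, stengleForm 1 + s • (stengleForm 1 - P) ∈ affineSpan ℝ
      (G : Set (Form 3 6)) := fun s => by
    have := AffineMap.lineMap_mem (-s) (hyT ▸ y.2) (subset_affineSpan ℝ _ hP)
    rw [AffineMap.lineMap_apply_module] at this
    convert this using 1
    module
  let f : ℝ → affineSpan ℝ (G : Set (Form 3 6)) := fun s => ⟨_, hmem s⟩
  have hf : Continuous f := (continuous_add_smul_form _ _).subtype_mk _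
  have hf0 : f 0 = y := Subtype.ext (by simp [f, hyT])
  have hev := (hf.tendsto 0).eventually (hf0 ▸ mem_interior_iff_mem_nhds.1 hy)
  obtain ⟨s, hs, hs0⟩ := ((hev.filter_mono nhdsWithin_le_nhds).and
    (self_mem_nhdsWithin (s := Set.Ioi (0 : ℝ)))).exists
  refine stengleFace_isFaceOf.mem_of_smul_add_smul_mem_left (hG.le hP) (hG.le hs) hs0 one_pos ?_
  refine mem_stengleFace.2 ?_
  obtain ⟨a, b, ha, hb, h⟩ := mem_stengleFace.1
    (stengleFace.smul_mem (add_nonneg zero_le_one hs0.le) stengleForm_one_mem_stengleFace)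
  refine ⟨a, b, ha, hb, ?_⟩
  rw [← h]
  simp only [f]
  module

theorem finrank_span_stengleFace :
    Module.finrank ℝ (Submodule.span ℝ (stengleFace : Set (Form 3 6))) = 2 := by
  have h : Submodule.span ℝ (stengleFace : Set (Form 3 6)) =
      Submodule.span ℝ (Set.range ![stengleForm 0, stengleForm √(256 / 27)]) := by
    rw [Matrix.range_cons, Matrix.range_cons, Matrix.range_empty, Set.union_empty,
      Set.singleton_union]
    exact le_antisymm (Submodule.span_le.2 (PointedCone.hull_le_span _ _))
      (Submodule.span_mono PointedCone.subset_hull)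
  rw [h, finrank_span_eq_card, Fintype.card_fin]
  rw [LinearIndependent.pair_iff]
  intro a b hab
  exact smul_add_smul_injective (hab.trans (by simp))

theorem mainTheorem11 :
    NonnegForms.IsStubborn (NonnegForms.stengleForm 1) ∧
    NonnegForms.stengleForm 1 ∈
      frontier (NonnegForms.nonnegCone 3 6 : Set (NonnegForms.Form 3 6)) ∧
    ¬ NonnegForms.IsExtremal (NonnegForms.stengleForm 1) ∧
    ∃ F : PointedCone ℝ (NonnegForms.Form 3 6),
      F.IsFaceOf (NonnegForms.nonnegCone 3 6) ∧
      NonnegForms.stengleForm 1 ∈ intrinsicInterior ℝ (F : Set (NonnegForms.Form 3 6)) ∧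
      (∀ G : PointedCone ℝ (NonnegForms.Form 3 6), G.IsFaceOf (NonnegForms.nonnegCone 3 6) →
        NonnegForms.stengleForm 1 ∈ G → F ≤ G) ∧
      (∀ G : PointedCone ℝ (NonnegForms.Form 3 6), G.IsFaceOf (NonnegForms.nonnegCone 3 6) →
        NonnegForms.stengleForm 1 ∈ intrinsicInterior ℝ (G : Set (NonnegForms.Form 3 6)) →
        G = F) ∧
      Module.finrank ℝ (Submodule.span ℝ (F : Set (NonnegForms.Form 3 6))) = 2 ∧
      F = PointedCone.hull ℝ
        {NonnegForms.stengleForm 0, NonnegForms.stengleForm (Real.sqrt (256 / 27))} ∧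
      NonnegForms.IsExtremal (NonnegForms.stengleForm 0) ∧
      NonnegForms.IsExtremal (NonnegForms.stengleForm (Real.sqrt (256 / 27))) := by
  have hm := one_lt_sqrt_256_div_27
  exact ⟨⟨stengleForm_mem_nonnegCone zero_le_one hm.le, not_isSumOfSquares_formPow_stengleForm⟩,
    stengleForm_one_mem_frontier, not_isExtremal_stengleForm_one, stengleFace,
    stengleFace_isFaceOf, stengleForm_one_mem_intrinsicInterior,
    fun _ hG hT => stengleFace_le_of_mem hG hT,
    fun _ hG hT => eq_stengleFace_of_mem_intrinsicInterior hG hT, finrank_span_stengleFace, rfl,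
    isExtremal_stengleForm_zero, isExtremal_stengleForm_sqrt⟩
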